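/- A standard probability space is a probability space isomorphic to $[0,1]$ with its Borel $\sigma$-algebra and Lebesgue measure. Let $\Gamma$ be a countable group. A pmp action of $\Gamma$ on a probability space is an action by measurable, measure-preserving bijections; for such an action $\alpha$ and $\gamma\in\Gamma$ write $\gamma^\alpha$ for the corresponding transformation. A pmp action $\alpha$ on $(X,\mu)$ is hyperfinite if for every finite $S\subseteq\Gamma$ and every $\varepsilon>0$ there is a finite group $G$ acting on $(X,\mu)$ in a measure-preserving way with $\mu(\{x\in X: S\cdot x\subseteq G\cdot x\})>1-\varepsilon$. Let $\mathrm{Sub}(\Gamma)\subseteq\{0,1\}^\Gamma$ be the space of subgroups of $\Gamma$. An IRS on $\Gamma$ is a Borel probability measure on $\mathrm{Sub}(\Gamma)$ invariant under conjugation; the IRS of a pmp action $\alpha$ on $(X,\mu)$ is the pushforward $\theta_\alpha$ of $\mu$ under $x\mapsto\{\gamma\in\Gamma:\gamma^\alpha x=x\}$. An IRS $\theta$ is hyperfinite if every pmp action of $\Gamma$ on a standard probability space with IRS $\theta$ is hyperfinite. **Theorem (approximate parametrized conjugacy for factor actions).** Let $(X,\mu)$ and $(Y,\nu)$ be standard probability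 spaces, let $A_1,\dots,A_k\subseteq X$ and $B_1,\dots,B_k\subseteq Y$ be Borel sets, and let $\theta$ be a hyperfinite IRS on $\Gamma$. Let $\alpha$ and $\beta$ be pmp actions of $\Gamma$ on $(X,\mu)$ and $(Y,\nu)$ respectively, both with IRS $\theta$. Let $\pi\colon Y\to X$ be a measure-preserving map such that for $\nu$-almost every $y\in Y$ one has $\pi(\gamma^\beta y)=\gamma^\alpha\pi(y)$ for all $\gamma\in\Gamma$, and suppose that $\pi^{-1}(A_i)=B_i$ for all $i\le k$. Then for every $\varepsilon>0$ and all $\gamma_1,\dots,\gamma_n\in\Gamma$ there is a measure-preserving Borel isomorphism $\rho\colon X\to Y$ such that $\rho(A_i)=B_i$ up to a $\nu$-null set for every $i\le k$, and $$\mu\bigl(\{x\in X:\ \forall i\le n,\ \rho(\gamma_i^\alpha(x))=\gamma_i^\beta(\rho(x))\}\bigr)>1-\varepsilon.$$ -/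

import Mathlib

open MeasureTheory

/-- `(X, μ)` is a standard probability space: it is isomorphic, as a measure space, to the unit
interval with its Borel σ-algebra and Lebesgue measure. -/
def IsStandardProbabilitySpace {X : Type*} [MeasurableSpace X] (μ : Measure X) : Prop :=
  ∃ e : X ≃ᵐ unitInterval, MeasurePreserving e μ volume

/-- The Borel σ-algebra of the space `Sub(Γ)` of subgroups of a countable group `Γ`, induced by
the inclusion `Sub(Γ) ⊆ {0,1}^Γ` (a subgroup is identified with its indicator function). -/
instance instMeasurableSpaceSubgroups (Γ : Type*) [Group Γ] : MeasurableSpace (Subgroup Γ) :=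
  MeasurableSpace.comap (fun (H : Subgroup Γ) (g : Γ) => g ∈ H) MeasurableSpace.pi

/-- The conjugation action of `Γ` on its subgroups: `g` sends `H` to `g H g⁻¹`. -/
def conjSubgroup {Γ : Type*} [Group Γ] (g : Γ) (H : Subgroup Γ) : Subgroup Γ :=
  H.map (MulAut.conj g).toMonoidHom

/-- An invariant random subgroup of `Γ`: a probability measure on `Sub(Γ)` which is invariant
under conjugation. -/
structure IsIRS {Γ : Type*} [Group Γ] (θ : Measure (Subgroup Γ)) : Prop where
  isProbabilityMeasure : IsProbabilityMeasure θ
  conj_invariant : ∀ g : Γ, MeasurePreserving (conjSubgroup g) θ θ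

/-- The invariant random subgroup of an action `Γ ↷ (X, μ)`: the pushforward of `μ` by
`x ↦ Stab(x)`. -/
noncomputable def actionIRS (Γ : Type*) {X : Type*} [Group Γ] [MulAction Γ X]
    [MeasurableSpace X] (μ : Measure X) : Measure (Subgroup Γ) :=
  μ.map (fun x : X => MulAction.stabilizer Γ x)

/-- A map into `Sub(Γ)` is measurable as soon as the events `g ∈ f x` are. -/
theorem measurable_to_subgroup {Γ X : Type*} [Group Γ] [MeasurableSpace X] {f : X → Subgroup Γ}
    (hf : ∀ g : Γ, MeasurableSet {x | g ∈ f x}) : Measurable f := by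
  rw [measurable_comap_iff]
  exact measurable_pi_iff.2 fun g => measurableSet_setOfPred.1 (hf g)

/-- On a standard probability space the stabilizer map is measurable, so that the pushforward
in `actionIRS` is a genuine one. -/
theorem measurable_stabilizer {Γ X : Type*} [Group Γ] [MulAction Γ X] [MeasurableSpace X]
    [MeasurableConstSMul Γ X] {μ : Measure X} (hμ : IsStandardProbabilitySpace μ) :
    Measurable (fun x : X => MulAction.stabilizer Γ x) := by
  obtain ⟨e, -⟩ := hμ
  refine measurable_to_subgroup fun g => ?_
  have h : {x : X | g ∈ MulAction.stabilizer Γ x} = {x | e (g • x) = e x} := by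
    ext x
    simp [MulAction.mem_stabilizer_iff]
  rw [h]
  exact measurableSet_eq_fun (e.measurable.comp (measurable_const_smul g)) e.measurable

/-- An action of `Γ` on `(X, μ)` is hyperfinite: for all finite `S ⊆ Γ` and `ε > 0` there is a
finite group `G` acting on `(X, μ)` in a measure-preserving way with
`μ {x | S • x ⊆ G • x} > 1 - ε`. -/
def IsHyperfiniteAction (Γ : Type*) {X : Type*} [Group Γ] [MulAction Γ X]
    [MeasurableSpace X] (μ : Measure X) : Prop :=
  ∀ (S : Finset Γ) (ε : ℝ), 0 < ε →
    ∃ (G : Type) (_ : Group G) (_ : Finite G) (_ : MulAction G X),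
      (∀ g : G, MeasurePreserving (fun x : X => g • x) μ μ) ∧
      1 - ε < μ.real {x : X | ∀ s ∈ S, s • x ∈ MulAction.orbit G x}

/-- A hyperfinite IRS on `Γ`: an IRS `θ` such that every pmp action of `Γ` on a standard
probability space with IRS `θ` is hyperfinite. (All standard probability spaces are isomorphic
to the unit interval, so the universe of `Z` is immaterial.) -/
structure IsHyperfiniteIRS {Γ : Type*} [Group Γ] (θ : Measure (Subgroup Γ)) : Prop where
  isIRS : IsIRS θ
  hyperfinite : ∀ (Z : Type) [MeasurableSpace Z] (η : Measure Z) [MulAction Γ Z]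
    [MeasurableConstSMul Γ Z] [SMulInvariantMeasure Γ Z η],
    IsStandardProbabilitySpace η → actionIRS Γ η = θ → IsHyperfiniteAction Γ η

/-- `π : Y → X` is an action factor map from `Γ ↷ (Y, ν)` to `Γ ↷ (X, μ)`: it is
measure-preserving and, for almost every `y`, `π (γ • y) = γ • π y` for all `γ`. -/
structure IsActionFactorMap (Γ : Type*) {X Y : Type*} [Group Γ] [MulAction Γ X] [MulAction Γ Y]
    [MeasurableSpace X] [MeasurableSpace Y] (μ : Measure X) (ν : Measure Y) (π : Y → X) :
    Prop where
  measurePreserving : MeasurePreserving π ν μ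
  ae_equivariant : ∀ᵐ y ∂ν, ∀ γ : Γ, π (γ • y) = γ • π y

/-! Hyperfiniteness of the action on `X` gives a finite group `G` such that, on a set of measure
more than `1 - ε`, every `γ i` moves `x` inside its `G`-orbit. The sets `Γx ∩ Gx` form finite
classes with Borel representatives `r x = (j x)⁻¹ • x` (`exists_measurable_section`).

Label a point `t` by the finite set of pairs `(g, a)` for which `j (g • t) = g` and `g • t` carries
the data `a`: its membership in the `A i`, and how the `γ i` move it within its class. There are
countably many labels, and `π` preserves measure, so the label of `t` and the label of `π y` have
the same law. Atomless spaces with equidistributed countable labellings are isomorphic along the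
labels (`exists_measurePreserving_equiv_of_labels`); this gives `φ : X ≃ᵐ Y`. Spreading it over the
classes by `ρ x = j x • φ (r x)` yields an isomorphism for which `π (ρ x)` carries the data of `x`
(`exists_equiv_of_section`).

Equality of the data makes `ρ` commute with `γ i` up to a group element fixing `π (ρ x)`. As the two
actions have the same IRS, `π` preserves almost every stabilizer (`ae_smul_eq_iff_of_actionIRS_eq`),
so this element also fixes `ρ x`. -/

/-! ### Borel isomorphisms from almost everywhere injective maps. -/

/-- Two Borel sets with the same injective image and uncountable complements are matched by a
Borel isomorphism of the ambient spaces that respects the given maps. -/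
theorem exists_measurableEquiv_of_image_eq {X Y Z : Type*} [MeasurableSpace X]
    [MeasurableSpace Y] [MeasurableSpace Z] [StandardBorelSpace X] [StandardBorelSpace Y]
    [MeasurableSpace.CountablySeparated Z] {f : X → Z} {g : Y → Z} (hf : Measurable f)
    (hg : Measurable g) {s : Set X} {t : Set Y} (hs : MeasurableSet s) (ht : MeasurableSet t)
    (hfs : Set.InjOn f s) (hgt : Set.InjOn g t) (hst : f '' s = g '' t)
    (hsc : ¬ Countable ↥sᶜ) (htc : ¬ Countable ↥tᶜ) :
    ∃ ρ : X ≃ᵐ Y, (∀ x, ρ x ∈ t ↔ x ∈ s) ∧ ∀ x ∈ s, g (ρ x) = f x := by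
  classical
  have := hs.standardBorel
  have := ht.standardBorel
  have := hs.compl.standardBorel
  have := ht.compl.standardBorel
  have e1 : MeasurableEmbedding (fun x : s => f x) :=
    (hf.comp measurable_subtype_coe).measurableEmbedding (Set.injOn_iff_injective.1 hfs)
  have e2 : MeasurableEmbedding (fun y : t => g y) :=
    (hg.comp measurable_subtype_coe).measurableEmbedding (Set.injOn_iff_injective.1 hgt)
  have hr : Set.range (fun x : s => f x) = Set.range (fun y : t => g y) := by
    rw [← Set.image_eq_range, ← Set.image_eq_range, hst]
  obtain ⟨e, he⟩ : ∃ e : s ≃ᵐ t, ∀ x, g (e x) = f x := by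
    have key : ∀ {R R' : Set Z} (_ : R = R') (a : s ≃ᵐ R) (b : t ≃ᵐ R'),
        ∃ e : s ≃ᵐ t, ∀ x, (b (e x) : Z) = a x := by
      rintro R R' rfl a b
      exact ⟨a.trans b.symm, fun x => by simp⟩
    obtain ⟨e, he⟩ := key hr e1.equivRange e2.equivRange
    refine ⟨e, fun x => ?_⟩
    have := he x
    rwa [e2.equivRange_apply, e1.equivRange_apply] at this
  let c : ↥sᶜ ≃ᵐ ↥tᶜ := PolishSpace.measurableEquivOfNotCountable hsc htc
  let ρ : X ≃ᵐ Y := (MeasurableEquiv.sumCompl hs).symm.trans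
    ((MeasurableEquiv.sumCongr e c).trans (MeasurableEquiv.sumCompl ht))
  have h1 : ∀ x (hx : x ∈ s), ρ x = e ⟨x, hx⟩ := by
    intro x hx
    have : (MeasurableEquiv.sumCompl hs).symm x = Sum.inl ⟨x, hx⟩ :=
      Equiv.Set.sumCompl_symm_apply_of_mem hx
    change MeasurableEquiv.sumCompl ht (MeasurableEquiv.sumCongr e c
      ((MeasurableEquiv.sumCompl hs).symm x)) = _
    rw [this]
    rfl
  have h2 : ∀ x (hx : x ∉ s), ρ x = c ⟨x, hx⟩ := by
    intro x hx
    have : (MeasurableEquiv.sumCompl hs).symm x = Sum.inr ⟨x, hx⟩ :=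
      Equiv.Set.sumCompl_symm_apply_of_notMem hx
    change MeasurableEquiv.sumCompl ht (MeasurableEquiv.sumCongr e c
      ((MeasurableEquiv.sumCompl hs).symm x)) = _
    rw [this]
    rfl
  refine ⟨ρ, fun x => ?_, fun x hx => by rw [h1 x hx, he]⟩
  by_cases hx : x ∈ s
  · simp [h1 x hx, hx]
  · rw [h2 x hx]
    exact iff_of_false (c ⟨x, hx⟩).2 hx

/-- An uncountable standard Borel space has an uncountable null Borel set. -/
theorem exists_measurableSet_null_not_countable {X : Type*} [MeasurableSpace X]
    [StandardBorelSpace X] (hX : ¬ Countable X) (μ : Measure X) [IsFiniteMeasure μ] :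
    ∃ N : Set X, MeasurableSet N ∧ μ N = 0 ∧ ¬ N.Countable := by
  have hR : ¬ Countable (ℝ × ℝ) := fun h => by
    have : Countable ℝ := (Prod.mk_right_injective (0 : ℝ)).countable
    exact Cardinal.not_countable_real ((Set.countable_univ_iff).2 this)
  let e : X ≃ᵐ ℝ × ℝ := PolishSpace.measurableEquivOfNotCountable hX hR
  have hm : ∀ t : ℝ, MeasurableSet ((fun x => (e x).1) ⁻¹' {t}) := fun t =>
    (measurable_fst.comp e.measurable) (measurableSet_singleton t)
  -- A finite measure charges only countably many of the disjoint vertical lines of the plane.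
  have hc : Set.Countable {t : ℝ | 0 < μ ((fun x => (e x).1) ⁻¹' {t})} :=
    Measure.countable_meas_pos_of_disjoint_iUnion hm fun i j hij =>
      Disjoint.preimage _ (by simpa using hij)
  obtain ⟨t, ht⟩ : ∃ t : ℝ, ¬ 0 < μ ((fun x => (e x).1) ⁻¹' {t}) := by
    by_contra! h
    exact Cardinal.not_countable_real (hc.mono fun t _ => h t)
  refine ⟨_, hm t, by simpa using ht, fun h => ?_⟩
  have h' : Set.Countable (Set.univ : Set ℝ) := by
    refine (h.image (fun x => (e x).2)).mono fun u _ => ?_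
    exact ⟨e.symm (t, u), by simp, by simp⟩
  exact Cardinal.not_countable_real h'

/-- Almost everywhere injective Borel maps with the same law are intertwined almost everywhere
by a measure-preserving Borel isomorphism. -/
theorem exists_measurePreserving_equiv_of_map_eq {X Y Z : Type*} [MeasurableSpace X]
    [MeasurableSpace Y] [MeasurableSpace Z] [StandardBorelSpace X] [StandardBorelSpace Y]
    [MeasurableSpace.CountablySeparated Z] {μ : Measure X} {ν : Measure Y}
    [IsFiniteMeasure μ] [IsFiniteMeasure ν] (hX : ¬ Countable X) (hY : ¬ Countable Y)
    {f : X → Z} {g : Y → Z} (hf : Measurable f) (hg : Measurable g)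
    {s : Set X} {t : Set Y} (hs : MeasurableSet s) (ht : MeasurableSet t)
    (hs0 : μ sᶜ = 0) (ht0 : ν tᶜ = 0)
    (hfs : Set.InjOn f s) (hgt : Set.InjOn g t) (hfg : μ.map f = ν.map g) :
    ∃ ρ : X ≃ᵐ Y, MeasurePreserving ρ μ ν ∧ ∀ᵐ x ∂μ, g (ρ x) = f x := by
  -- Removing uncountable null sets leaves uncountable complements, which are then automatically
  -- Borel isomorphic.
  obtain ⟨N, hN, hN0, hNc⟩ := exists_measurableSet_null_not_countable hX μ
  obtain ⟨M, hM, hM0, hMc⟩ := exists_measurableSet_null_not_countable hY ν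
  have hs' : MeasurableSet (s \ N) := hs.diff hN
  have ht' : MeasurableSet (t \ M) := ht.diff hM
  have hfs' : Set.InjOn f (s \ N) := hfs.mono Set.sdiff_subset
  have hgt' : Set.InjOn g (t \ M) := hgt.mono Set.sdiff_subset
  have hs0' : μ (s \ N)ᶜ = 0 := by
    refine measure_mono_null (t := sᶜ ∪ N) ?_ (measure_union_null hs0 hN0)
    intro x; simp only [Set.mem_compl_iff, Set.mem_sdiff, Set.mem_union]; tauto
  have ht0' : ν (t \ M)ᶜ = 0 := by
    refine measure_mono_null (t := tᶜ ∪ M) ?_ (measure_union_null ht0 hM0)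
    intro x; simp only [Set.mem_compl_iff, Set.mem_sdiff, Set.mem_union]; tauto
  have hfi := hs'.image_of_measurable_injOn hf hfs'
  have hgi := ht'.image_of_measurable_injOn hg hgt'
  -- The common part of the two images; it is conull for the shared law of `f` and `g`.
  set W := f '' (s \ N) ∩ g '' (t \ M) with hW
  have hWm : MeasurableSet W := hfi.inter hgi
  have hfW : μ (f ⁻¹' W)ᶜ = 0 := by
    have h1 : μ (f ⁻¹' (f '' (s \ N))ᶜ) = 0 :=
      measure_mono_null (fun x hx hxs => hx ⟨x, hxs, rfl⟩) hs0'
    have h2 : μ (f ⁻¹' (g '' (t \ M))ᶜ) = 0 := by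
      rw [← Measure.map_apply hf hgi.compl, hfg, Measure.map_apply hg hgi.compl]
      exact measure_mono_null (fun x hx hxs => hx ⟨x, hxs, rfl⟩) ht0'
    rw [← Set.preimage_compl, hW, Set.compl_inter, Set.preimage_union]
    exact measure_union_null h1 h2
  have hgW : ν (g ⁻¹' W)ᶜ = 0 := by
    rw [← Set.preimage_compl, ← Measure.map_apply hg hWm.compl, ← hfg,
      Measure.map_apply hf hWm.compl]
    exact hfW
  have hs1 : MeasurableSet ((s \ N) ∩ f ⁻¹' W) := hs'.inter (hf hWm)
  have ht1 : MeasurableSet ((t \ M) ∩ g ⁻¹' W) := ht'.inter (hg hWm)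
  have hs1c : μ ((s \ N) ∩ f ⁻¹' W)ᶜ = 0 := by
    rw [Set.compl_inter]; exact measure_union_null hs0' hfW
  have ht1c : ν ((t \ M) ∩ g ⁻¹' W)ᶜ = 0 := by
    rw [Set.compl_inter]; exact measure_union_null ht0' hgW
  have hgt1 := hgt'.mono (Set.inter_subset_left (t := g ⁻¹' W))
  obtain ⟨ρ, hρ1, hρ2⟩ := exists_measurableEquiv_of_image_eq hf hg hs1 ht1
    (hfs'.mono Set.inter_subset_left) hgt1
    (by rw [Set.image_inter_preimage, Set.image_inter_preimage, hW]
        ext; simp only [Set.mem_inter_iff]; tauto)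
    (fun h => hNc (Set.Countable.mono
      (fun x hx h' => h'.1.2 hx : N ⊆ ((s \ N) ∩ f ⁻¹' W)ᶜ) (Set.countable_coe_iff.1 h)))
    (fun h => hMc (Set.Countable.mono
      (fun x hx h' => h'.1.2 hx : M ⊆ ((t \ M) ∩ g ⁻¹' W)ᶜ) (Set.countable_coe_iff.1 h)))
  have hae : ∀ᵐ x ∂μ, x ∈ (s \ N) ∩ f ⁻¹' W := hs1c
  have haey : ∀ᵐ y ∂ν, y ∈ (t \ M) ∩ g ⁻¹' W := ht1c
  refine ⟨ρ, ⟨ρ.measurable, ?_⟩, hae.mono hρ2⟩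
  ext B hB
  rw [Measure.map_apply ρ.measurable hB]
  have hBi : MeasurableSet (g '' (B ∩ ((t \ M) ∩ g ⁻¹' W))) :=
    (hB.inter ht1).image_of_measurable_injOn hg (hgt1.mono Set.inter_subset_right)
  have hmem : ∀ y ∈ (t \ M) ∩ g ⁻¹' W, (g y ∈ g '' (B ∩ ((t \ M) ∩ g ⁻¹' W)) ↔ y ∈ B) := by
    intro y hy
    constructor
    · rintro ⟨z, hz, hzy⟩
      exact hgt1 hz.2 hy hzy ▸ hz.1
    · exact fun h => ⟨y, ⟨h, hy⟩, rfl⟩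
  have e1 : μ (ρ ⁻¹' B) = μ (f ⁻¹' (g '' (B ∩ ((t \ M) ∩ g ⁻¹' W)))) := by
    refine measure_congr ?_
    filter_upwards [hae] with x hx
    refine propext ?_
    change ρ x ∈ B ↔ f x ∈ g '' (B ∩ ((t \ M) ∩ g ⁻¹' W))
    rw [← hρ2 x hx, hmem _ ((hρ1 x).2 hx)]
  have e2 : ν B = ν (g ⁻¹' (g '' (B ∩ ((t \ M) ∩ g ⁻¹' W)))) := by
    refine measure_congr ?_
    filter_upwards [haey] with y hy
    exact propext (hmem y hy).symm
  rw [e1, e2, ← Measure.map_apply hf hBi, hfg, Measure.map_apply hg hBi]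

/-! ### Atomless measures and countable labellings. -/

/-- The distribution function of a finite atomless measure on the line pushes it forward to
Lebesgue measure on an interval. -/
theorem map_measureReal_Iic (m : Measure ℝ) [IsFiniteMeasure m] [NullSingletonClass m] :
    Measurable (fun u => m.real (Set.Iic u)) ∧
    m.map (fun u => m.real (Set.Iic u)) =
      volume.restrict (Set.Ioc 0 (m.real Set.univ)) := by
  set F : ℝ → ℝ := fun u => m.real (Set.Iic u) with hF
  have hmono : Monotone F := fun a b hab => measureReal_mono (Set.Iic_subset_Iic.2 hab)
  have hbot : Filter.Tendsto F Filter.atBot (nhds 0) := by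
    have h := tendsto_measure_iInter_atBot (μ := m) (s := Set.Iic)
      (fun i => (measurableSet_Iic (a := i)).nullMeasurableSet) (fun a b => Set.Iic_subset_Iic.2)
      ⟨0, measure_ne_top m _⟩
    have h0 : ⋂ u : ℝ, Set.Iic u = ∅ := Set.eq_empty_of_forall_notMem fun x hx => by
      have := Set.mem_iInter.1 hx (x - 1)
      rw [Set.mem_Iic] at this
      linarith
    rw [h0, measure_empty] at h
    exact (ENNReal.tendsto_toReal ENNReal.zero_ne_top).comp h
  have htop : Filter.Tendsto F Filter.atTop (nhds (m.real Set.univ)) :=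
    (ENNReal.tendsto_toReal (measure_ne_top m _)).comp (tendsto_measure_Iic_atTop m)
  have hcont : Continuous F := by
    -- Up to a constant, `F` is the primitive of `1` with respect to `m`, hence continuous as `m`
    -- has no atoms.
    have h := intervalIntegral.continuous_primitive (μ := m) (f := fun _ => (1 : ℝ))
      (fun a b => ⟨by simp, by simp⟩) 0
    have h' : F = fun u => F 0 + ∫ x in (0:ℝ)..u, (1 : ℝ) ∂m := by
      funext u
      rw [← intervalIntegral.integral_Iic_sub_Iic (by simp) (by simp)]
      simp [hF]
    rw [h']
    exact h.const_add _
  refine ⟨hcont.measurable, ?_⟩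
  have hle : ∀ u, F u ≤ m.real Set.univ := fun u => measureReal_mono (Set.subset_univ _)
  have hbd : ∀ c, 0 < c → c < m.real Set.univ →
      m.real {u | F u < c} ≤ c ∧ c ≤ m.real {u | F u ≤ c} := by
    intro c hc hc'
    -- If `F u = c`, then `Iic u` has measure `c` and lies between `{F < c}` and `{F ≤ c}`.
    obtain ⟨u, hu⟩ : c ∈ Set.range F := mem_range_of_exists_le_of_exists_ge hcont
      ((hbot.eventually_lt_const hc).exists.imp fun _ h => h.le)
      ((htop.eventually_const_lt hc').exists.imp fun _ h => h.le)
    constructor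
    · conv_rhs => rw [← hu]
      exact measureReal_mono fun v hv => (hmono.reflect_lt (hu ▸ hv)).le
    · conv_lhs => rw [← hu]
      exact measureReal_mono fun v hv => (hmono hv).trans hu.le
  have hlt : ∀ c, 0 < c → m.real {u | F u < c} ≤ c := by
    intro c hc
    rcases lt_or_ge c (m.real Set.univ) with h | h
    · exact (hbd c hc h).1
    · exact (measureReal_mono (Set.subset_univ _)).trans h
  refine Measure.ext_of_Iic _ _ fun c => ?_
  rw [Measure.map_apply hcont.measurable measurableSet_Iic,
    Measure.restrict_apply measurableSet_Iic]
  rcases lt_or_ge c (m.real Set.univ) with h | h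
  · have hI : Set.Iic c ∩ Set.Ioc 0 (m.real Set.univ) = Set.Ioc 0 c := by
      ext x; simp only [Set.mem_inter_iff, Set.mem_Iic, Set.mem_Ioc]
      exact ⟨fun h => ⟨h.2.1, h.1⟩, fun h' => ⟨h'.2, h'.1, h'.2.trans h.le⟩⟩
    rw [hI, Real.volume_Ioc, sub_zero]
    -- Strict sublevel sets at levels `d > c` bound this one; the maximum with `0` covers negative
    -- `c`.
    have hup : m.real (F ⁻¹' Set.Iic c) ≤ max c 0 := by
      refine le_of_forall_gt_imp_ge_of_dense fun d hd => ?_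
      refine le_trans (measureReal_mono fun u hu => ?_)
        (hlt d ((le_max_right _ _).trans_lt hd))
      exact lt_of_le_of_lt hu ((le_max_left _ _).trans_lt hd)
    rw [← ENNReal.ofReal_toReal (measure_ne_top m (F ⁻¹' Set.Iic c))]
    change ENNReal.ofReal (m.real _) = _
    rcases le_or_gt c 0 with hc | hc
    · rw [max_eq_right hc] at hup
      rw [ENNReal.ofReal_of_nonpos hc, ENNReal.ofReal_of_nonpos hup]
    · rw [max_eq_left hc.le] at hup
      rw [le_antisymm hup (hbd c hc h).2]
  · have hI : Set.Iic c ∩ Set.Ioc 0 (m.real Set.univ) = Set.Ioc 0 (m.real Set.univ) :=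
      Set.inter_eq_right.2 fun x hx => hx.2.trans h
    have hU : F ⁻¹' Set.Iic c = Set.univ := Set.eq_univ_of_forall fun u => (hle u).trans h
    rw [hI, hU, Real.volume_Ioc, sub_zero]
    exact (ENNReal.ofReal_toReal (measure_ne_top m _)).symm

/-- The distribution function of a finite atomless measure is injective off a null set. -/
theorem exists_injOn_measureReal_Iic (m : Measure ℝ) [IsFiniteMeasure m] [NullSingletonClass m] :
    ∃ N : Set ℝ, MeasurableSet N ∧ m N = 0 ∧ Set.InjOn (fun u => m.real (Set.Iic u)) Nᶜ := by
  obtain ⟨hm, hmap⟩ := map_measureReal_Iic m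
  set F : ℝ → ℝ := fun u => m.real (Set.Iic u) with hF
  have hmono : Monotone F := fun a b hab => measureReal_mono (Set.Iic_subset_Iic.2 hab)
  refine ⟨⋃ q : ℚ, F ⁻¹' {F q}, .iUnion fun q => hm (measurableSet_singleton _), ?_, ?_⟩
  · refine measure_iUnion_null fun q => ?_
    rw [← Measure.map_apply hm (measurableSet_singleton _), hmap]
    exact measure_singleton _
  -- Two points with the same value enclose a rational with that value, so both lie in one of
  -- countably many null level sets.
  · have key : ∀ u v, u < v → F u = F v → u ∈ ⋃ q : ℚ, F ⁻¹' {F q} := by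
      intro u v huv h
      obtain ⟨q, hq1, hq2⟩ := exists_rat_btwn huv
      exact Set.mem_iUnion.2 ⟨q, le_antisymm (hmono hq1.le) (h ▸ hmono hq2.le)⟩
    intro u hu v hv h
    rcases lt_trichotomy u v with h1 | h1 | h1
    · exact (hu (key u v h1 h)).elim
    · exact h1
    · exact (hv (key v u h1 h.symm)).elim

/-- An atomless finite measure with a countable labelling is carried, injectively off a null set
and respecting labels, onto a measure which depends only on the weights of the labels. -/
theorem exists_normalForm {X I : Type*} [MeasurableSpace X] [StandardBorelSpace X] [Countable I]
    [MeasurableSpace I] [DiscreteMeasurableSpace I] (μ : Measure X) [IsFiniteMeasure μ]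
    [NullSingletonClass μ] {τ : X → I} (hτ : Measurable τ) :
    ∃ f : X → I × ℝ, Measurable f ∧ (∀ x, (f x).1 = τ x) ∧
      (∃ s, MeasurableSet s ∧ μ sᶜ = 0 ∧ Set.InjOn f s) ∧
      ∀ S : Set (I × ℝ), MeasurableSet S → μ (f ⁻¹' S) =
        ∑' i, volume.restrict (Set.Ioc 0 (μ.real (τ ⁻¹' {i}))) (Prod.mk i ⁻¹' S) := by
  have he := measurableEmbedding_embeddingReal X
  set e := embeddingReal X
  have hτi : ∀ i, MeasurableSet (τ ⁻¹' {i}) := fun i => hτ (measurableSet_singleton i)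
  -- Each label class is transported to the line and straightened by its own distribution function.
  let m : I → Measure ℝ := fun i => (μ.restrict (τ ⁻¹' {i})).map e
  have hm : ∀ i, NullSingletonClass (m i) := fun i => ⟨fun u => by
    rw [Measure.map_apply he.measurable (measurableSet_singleton u)]
    exact (Set.subsingleton_singleton.preimage he.injective).measure_zero _⟩
  have hmu : ∀ i, (m i).real Set.univ = μ.real (τ ⁻¹' {i}) := fun i => by
    simp [m, measureReal_def, Measure.map_apply he.measurable]
  choose N hN hN0 hNi using fun i => exists_injOn_measureReal_Iic (m i)
  have hF := fun i => map_measureReal_Iic (m i)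
  have hfm : Measurable fun x => (m (τ x)).real (Set.Iic (e x)) := by
    have : Measurable fun p : I × ℝ => (m p.1).real (Set.Iic p.2) :=
      measurable_from_prod_countable_right fun i => (hF i).1
    exact this.comp (hτ.prodMk he.measurable)
  refine ⟨fun x => (τ x, (m (τ x)).real (Set.Iic (e x))), hτ.prodMk hfm, fun _ => rfl,
    ⟨⋂ i, (τ ⁻¹' {i} ∩ e ⁻¹' N i)ᶜ,
      .iInter fun i => ((hτi i).inter (he.measurable (hN i))).compl, ?_, ?_⟩, fun S hS => ?_⟩
  · rw [Set.compl_iInter]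
    refine measure_iUnion_null fun i => ?_
    rw [compl_compl, Set.inter_comm, ← Measure.restrict_apply (he.measurable (hN i)),
      ← Measure.map_apply he.measurable (hN i)]
    exact hN0 i
  · intro x hx y hy hxy
    have h1 : τ x = τ y := congrArg Prod.fst hxy
    have h2 := congrArg Prod.snd hxy
    dsimp only at h2
    rw [h1] at h2
    refine he.injective (hNi (τ y) (fun h => ?_) (fun h => ?_) h2)
    · exact Set.mem_iInter.1 hx (τ y) ⟨h1, h⟩
    · exact Set.mem_iInter.1 hy (τ y) ⟨rfl, h⟩
  · have hSi : ∀ i, MeasurableSet (Prod.mk i ⁻¹' S) := fun i => measurable_prodMk_left hS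
    have hU : (fun x => (τ x, (m (τ x)).real (Set.Iic (e x)))) ⁻¹' S =
        ⋃ i, (e ⁻¹' ((fun u => (m i).real (Set.Iic u)) ⁻¹' (Prod.mk i ⁻¹' S))) ∩ τ ⁻¹' {i} := by
      ext x
      simp
    rw [hU, measure_iUnion]
    · refine tsum_congr fun i => ?_
      rw [← hmu i, ← (hF i).2, Measure.map_apply (hF i).1 (hSi i),
        Measure.map_apply he.measurable ((hF i).1 (hSi i)),
        Measure.restrict_apply (he.measurable ((hF i).1 (hSi i)))]
    · intro i j hij
      refine Set.disjoint_left.2 fun x hx hy => hij ?_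
      exact hx.2.symm.trans hy.2
    · exact fun i => (he.measurable ((hF i).1 (hSi i))).inter (hτi i)

/-- Atomless finite standard Borel measure spaces with countable labellings of the same law
are isomorphic by a measure-preserving Borel isomorphism which respects labels. -/
theorem exists_measurePreserving_equiv_of_labels {X Y I : Type*} [MeasurableSpace X]
    [MeasurableSpace Y] [StandardBorelSpace X] [StandardBorelSpace Y] [Countable I]
    [MeasurableSpace I] [DiscreteMeasurableSpace I] {μ : Measure X} {ν : Measure Y}
    [IsFiniteMeasure μ] [IsFiniteMeasure ν] [NullSingletonClass μ] [NullSingletonClass ν]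
    (hX : ¬ Countable X) (hY : ¬ Countable Y) {τ : X → I} {σ : Y → I} (hτ : Measurable τ)
    (hσ : Measurable σ) (hτσ : ∀ i, μ (τ ⁻¹' {i}) = ν (σ ⁻¹' {i})) :
    ∃ ρ : X ≃ᵐ Y, MeasurePreserving ρ μ ν ∧ ∀ᵐ x ∂μ, σ (ρ x) = τ x := by
  obtain ⟨f, hf, hfτ, ⟨s, hs, hs0, hfs⟩, hfl⟩ := exists_normalForm μ hτ
  obtain ⟨g, hg, hgσ, ⟨t, ht, ht0, hgt⟩, hgl⟩ := exists_normalForm ν hσ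
  obtain ⟨ρ, hρ, h⟩ := exists_measurePreserving_equiv_of_map_eq hX hY hf hg hs ht hs0 ht0 hfs hgt
    (by
      ext S hS
      rw [Measure.map_apply hf hS, Measure.map_apply hg hS, hfl S hS, hgl S hS]
      simp only [measureReal_def, hτσ])
  exact ⟨ρ, hρ, h.mono fun x hx => by rw [← hgσ, hx, hfτ]⟩

theorem measurable_of_fibers {X Y I : Type*} [MeasurableSpace X] [MeasurableSpace Y]
    [Countable I] {j : X → I} (hj : ∀ i, MeasurableSet (j ⁻¹' {i})) {F : I → X → Y}
    (hF : ∀ i, Measurable (F i)) : Measurable fun x => F (j x) x := by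
  intro B hB
  have : (fun x => F (j x) x) ⁻¹' B = ⋃ i, j ⁻¹' {i} ∩ F i ⁻¹' B := by
    ext x
    simp
  rw [this]
  exact .iUnion fun i => (hj i).inter (hF i hB)

theorem measure_eq_tsum_fibers {X I : Type*} [MeasurableSpace X] [Countable I] (μ : Measure X)
    {j : X → I} (hj : ∀ i, MeasurableSet (j ⁻¹' {i})) {B : Set X} (hB : MeasurableSet B) :
    μ B = ∑' i, μ (j ⁻¹' {i} ∩ B) := by
  rw [← measure_iUnion]
  · congr 1
    ext x
    simp
  · exact fun i i' h => Set.disjoint_left.2 fun x hx hx' => h (hx.1.symm.trans hx'.1)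
  · exact fun i => (hj i).inter hB

theorem measurable_finset_of_mem {X C : Type*} [MeasurableSpace X] [Countable C]
    [MeasurableSpace (Finset C)] {τ : X → Finset C} (h : ∀ c, MeasurableSet {x | c ∈ τ x}) :
    Measurable τ := by
  refine measurable_to_countable' fun s => ?_
  have : τ ⁻¹' {s} = ⋂ c, {x | c ∈ τ x ↔ c ∈ s} := by
    ext x
    simp [Finset.ext_iff]
  rw [this]
  refine .iInter fun c => ?_
  by_cases hc : c ∈ s
  · simpa only [hc, iff_true] using h c
  · simp only [hc, iff_false]
    exact (h c).compl

/-! ### Stabilizers and Borel representatives. -/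

/-- If a factor map preserves the law of the stabilizers, it preserves almost every stabilizer. -/
theorem ae_smul_eq_iff_of_actionIRS_eq {Γ X Y : Type*} [Group Γ] [Countable Γ]
    [MeasurableSpace X] [MeasurableSpace Y] {μ : Measure X} {ν : Measure Y}
    (hμ : IsStandardProbabilitySpace μ) (hν : IsStandardProbabilitySpace ν) [IsFiniteMeasure ν]
    [MulAction Γ X] [MeasurableConstSMul Γ X] [MulAction Γ Y] [MeasurableConstSMul Γ Y]
    (h : actionIRS Γ μ = actionIRS Γ ν) {π : Y → X} (hπ : IsActionFactorMap Γ μ ν π) :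
    ∀ᵐ y ∂ν, ∀ γ : Γ, γ • y = y ↔ γ • π y = π y := by
  refine ae_all_iff.2 fun γ => ?_
  have hH : MeasurableSet {H : Subgroup Γ | γ ∈ H} :=
    ⟨{p | p γ}, measurableSet_setOfPred.2 (measurable_pi_apply γ), rfl⟩
  have hX : MeasurableSet {x : X | γ • x = x} := measurable_stabilizer hμ hH
  have hY : MeasurableSet {y : Y | γ • y = y} := measurable_stabilizer hν hH
  -- Both sides equal the mass that the common IRS gives to `{H | γ ∈ H}`; with the inclusion coming
  -- from equivariance, equal finite measure forces almost everywhere equality.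
  have e : ν {y : Y | γ • y = y} = ν (π ⁻¹' {x : X | γ • x = x}) := by
    rw [hπ.measurePreserving.measure_preimage hX.nullMeasurableSet]
    have := congrArg (fun θ => θ {H : Subgroup Γ | γ ∈ H}) h
    simp only [actionIRS] at this
    rw [Measure.map_apply (measurable_stabilizer hμ) hH,
      Measure.map_apply (measurable_stabilizer hν) hH] at this
    exact this.symm
  have := ae_eq_of_ae_subset_of_measure_ge (μ := ν) (s := {y : Y | γ • y = y})
    (t := π ⁻¹' {x : X | γ • x = x})
    (by filter_upwards [hπ.ae_equivariant] with y hy h'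
        change γ • π y = π y
        rw [← hy γ]
        exact congrArg π h') e.ge hY.nullMeasurableSet (measure_ne_top ν _)
  filter_upwards [this] with y hy
  exact Iff.of_eq hy

/-- The common refinement of the orbits of a countable group `Γ` and of a finite group `G` admits
a Borel choice of representatives `(j x)⁻¹ • x`. -/
theorem exists_measurable_section {Γ G X : Type*} [Group Γ] [Countable Γ] [Group G] [Finite G]
    [MeasurableSpace X] [StandardBorelSpace X] [MulAction Γ X] [MeasurableConstSMul Γ X]
    [MulAction G X] (hG : ∀ g : G, Measurable fun x : X => g • x) :
    ∃ j : X → Γ, (∀ γ, MeasurableSet (j ⁻¹' {γ})) ∧ (∀ t, {x | (j x)⁻¹ • x = t}.Finite) ∧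
      ∀ (x : X) (γ : Γ), γ • x ∈ MulAction.orbit G x →
        (j (γ • x))⁻¹ • γ • x = (j x)⁻¹ • x := by
  classical
  have he := measurableEmbedding_embeddingReal X
  set e := embeddingReal X
  -- The points with the least real code in their finite class `Γx ∩ Gx`.
  let T : Set X := {x | ∀ (g : G) (γ : Γ), g • x = γ • x → e x ≤ e (g • x)}
  have hΓ : ∀ γ : Γ, Measurable fun x : X => γ • x := fun γ => measurable_const_smul γ
  have hT : MeasurableSet T := by
    have : T = ⋂ (g : G) (γ : Γ), {x : X | g • x = γ • x}ᶜ ∪ {x | e x ≤ e (g • x)} := by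
      ext x
      simp [T, imp_iff_not_or]
    rw [this]
    exact .iInter fun g => .iInter fun γ => (measurableSet_eq_fun (hG g) (hΓ γ)).compl.union
      (measurableSet_le he.measurable (he.measurable.comp (hG g)))
  have hT_unique : ∀ {a b : X} (g : G) (γ : Γ), a ∈ T → b ∈ T → b = g • a → b = γ • a → a = b := by
    intro a b g γ ha hb h1 h2
    refine he.injective (le_antisymm ?_ ?_)
    · have := ha g γ (h1.symm.trans h2)
      rwa [← h1] at this
    · have := hb g⁻¹ γ⁻¹ (by rw [inv_smul_eq_iff.2 h1, inv_smul_eq_iff.2 h2])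
      rwa [inv_smul_eq_iff.2 h1] at this
  have hex : ∀ x : X, ∃ γ : Γ, γ⁻¹ • x ∈ T ∧ ∃ g : G, γ⁻¹ • x = g • x := by
    intro x
    obtain ⟨g₀, ⟨γ₀, h₀⟩, hmin⟩ := Set.exists_min_image {g : G | ∃ γ : Γ, γ • x = g • x}
      (fun g => e (g • x)) (Set.toFinite _) ⟨1, 1, by simp⟩
    refine ⟨γ₀⁻¹, fun g γ h => ?_, g₀, by simpa using h₀⟩
    rw [inv_inv] at h ⊢
    rw [h₀, ← mul_smul] at h ⊢
    refine hmin _ ⟨γ * γ₀, ?_⟩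
    rw [h, mul_smul, h₀]
  -- Taking the first suitable element in an enumeration of `Γ` makes the choice Borel.
  obtain ⟨enc, henc⟩ := exists_surjective_nat Γ
  have hex' : ∀ x : X, ∃ m : ℕ, (enc m)⁻¹ • x ∈ T ∧ ∃ g : G, (enc m)⁻¹ • x = g • x := by
    intro x
    obtain ⟨γ, hγ⟩ := hex x
    obtain ⟨m, rfl⟩ := henc γ
    exact ⟨m, hγ⟩
  have hfind : Measurable fun x => Nat.find (hex' x) := by
    refine measurable_find hex' fun m => (hΓ _ hT).inter ?_
    have : {x : X | ∃ g : G, (enc m)⁻¹ • x = g • x} =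
        ⋃ g : G, {x | (enc m)⁻¹ • x = g • x} := by
      ext x
      simp
    change MeasurableSet {x : X | ∃ g : G, (enc m)⁻¹ • x = g • x}
    rw [this]
    exact .iUnion fun g => measurableSet_eq_fun (hΓ _) (hG g)
  have hspec := fun x => Nat.find_spec (hex' x)
  refine ⟨fun x => enc (Nat.find (hex' x)), fun γ => ?_, fun t => ?_, fun x γ hγ => ?_⟩
  · exact hfind (MeasurableSet.of_discrete (s := enc ⁻¹' {γ}))
  · refine (Set.finite_range fun g : G => g • t).subset fun x hx => ?_
    obtain ⟨-, g, hg⟩ := hspec x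
    exact ⟨g⁻¹, by rw [← show _ = t from hx]; exact inv_smul_eq_iff.2 hg⟩
  · obtain ⟨h, hh⟩ := hγ
    obtain ⟨ha, g, hg⟩ := hspec x
    obtain ⟨hb, g', hg'⟩ := hspec (γ • x)
    refine (hT_unique (g' * h * g⁻¹)
      ((enc (Nat.find (hex' (γ • x))))⁻¹ * γ * enc (Nat.find (hex' x))) ha hb ?_ ?_).symm
    · rw [hg', hg, mul_smul, mul_smul, inv_smul_smul]
      exact congrArg _ hh.symm
    · rw [mul_smul, mul_smul, smul_inv_smul]

/-! ### Spreading an isomorphism from representatives to classes. -/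

/-- Along a factor map, a measure-preserving Borel isomorphism can be chosen that
preserves a countable labelling and is equivariant on the fibres of a Borel choice of
representatives `(j x)⁻¹ • x` with finite fibres. -/
theorem exists_equiv_of_section {Γ X Y D : Type*} [Group Γ] [Countable Γ] [Countable D]
    [MeasurableSpace X] [MeasurableSpace Y] [StandardBorelSpace X] [StandardBorelSpace Y]
    {μ : Measure X} {ν : Measure Y} [IsFiniteMeasure μ] [IsFiniteMeasure ν]
    [NullSingletonClass μ] [NullSingletonClass ν] (hX : ¬ Countable X) (hY : ¬ Countable Y)
    [MulAction Γ X] [MeasurableConstSMul Γ X] [SMulInvariantMeasure Γ X μ]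
    [MulAction Γ Y] [MeasurableConstSMul Γ Y] [SMulInvariantMeasure Γ Y ν]
    {π : Y → X} (hπ : IsActionFactorMap Γ μ ν π)
    {j : X → Γ} (hj : ∀ γ, MeasurableSet (j ⁻¹' {γ}))
    (hfin : ∀ t, {x | (j x)⁻¹ • x = t}.Finite) {d : X → D} (hd : ∀ a, MeasurableSet (d ⁻¹' {a})) :
    ∃ (ρ : X ≃ᵐ Y) (φ : X → Y), MeasurePreserving ρ μ ν ∧
      ∀ᵐ x ∂μ, ρ x = j x • φ ((j x)⁻¹ • x) ∧ j (π (ρ x)) = j x ∧ d (π (ρ x)) = d x := by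
  classical
  have hΓX : ∀ γ : Γ, Measurable fun x : X => γ • x := fun γ => measurable_const_smul γ
  have hΓY : ∀ γ : Γ, Measurable fun y : Y => γ • y := fun γ => measurable_const_smul γ
  have hπm := hπ.measurePreserving.measurable
  have hτfin : ∀ t : X, {c : Γ × D | j (c.1 • t) = c.1 ∧ d (c.1 • t) = c.2}.Finite := fun t => by
    refine ((hfin t).image fun x => (j x, d x)).subset fun c hc => ⟨c.1 • t, ?_, ?_⟩
    · simp [hc.1]
    · exact Prod.ext hc.1 hc.2
  -- Finiteness of the fibres keeps the label space countable. Points that represent nothing get the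
  -- empty label.
  let τ : X → Finset (Γ × D) := fun t => (hτfin t).toFinset
  have hτmem : ∀ t c, c ∈ τ t ↔ j (c.1 • t) = c.1 ∧ d (c.1 • t) = c.2 := fun t c => by
    simp [τ]
  let : MeasurableSpace (Finset (Γ × D)) := ⊤
  have hτ : Measurable τ := measurable_finset_of_mem fun c => by
    simp only [hτmem]
    exact (hΓX c.1 (hj c.1)).inter (hΓX c.1 (hd c.2))
  obtain ⟨φ, hφ, hφτ⟩ := exists_measurePreserving_equiv_of_labels (μ := μ) (ν := ν) hX hY hτ
    (hτ.comp hπm) fun s => by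
      rw [Set.preimage_comp, hπ.measurePreserving.measure_preimage
        (hτ (MeasurableSet.of_discrete)).nullMeasurableSet]
  have hj_iff : ∀ {s t : X}, τ s = τ t → ∀ g, j (g • s) = g → j (g • t) = g := by
    intro s t h g hg
    exact ((hτmem t (g, d (g • s))).1 (h ▸ (hτmem s (g, d (g • s))).2 ⟨hg, rfl⟩)).1
  let ρ₀ : X → Y := fun x => j x • φ ((j x)⁻¹ • x)
  have hρ₀ : Measurable ρ₀ :=
    measurable_of_fibers hj (F := fun γ x => γ • φ (γ⁻¹ • x)) fun γ =>
      (hΓY γ).comp (φ.measurable.comp (hΓX γ⁻¹))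
  -- On `{j = g}` the map is `g ∘ φ ∘ g⁻¹`, and since `φ` respects labels its image is `{j ∘ π = g}`
  -- up to null sets; these pieces partition `X` and `Y`.
  have hmap : μ.map ρ₀ = ν := by
    ext B hB
    rw [Measure.map_apply hρ₀ hB, measure_eq_tsum_fibers μ hj (hρ₀ hB),
      measure_eq_tsum_fibers ν (j := j ∘ π) (fun γ => hπm (hj γ)) hB]
    refine tsum_congr fun g => ?_
    have hE : MeasurableSet {y : Y | j (g • π y) = g ∧ g • y ∈ B} :=
      (((hΓX g).comp hπm) (hj g)).inter (hΓY g hB)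
    have e1 : j ⁻¹' {g} ∩ ρ₀ ⁻¹' B =
        (fun x : X => g⁻¹ • x) ⁻¹' {t : X | j (g • t) = g ∧ g • φ t ∈ B} := by
      ext x
      simp only [Set.mem_inter_iff, Set.mem_preimage, Set.mem_singleton_iff, Set.mem_ofPred_eq,
        smul_inv_smul, ρ₀]
      refine and_congr_right fun h => ?_
      rw [h]
    have e2 : μ {t : X | j (g • t) = g ∧ g • φ t ∈ B} =
        μ (φ ⁻¹' {y : Y | j (g • π y) = g ∧ g • y ∈ B}) := by
      refine measure_congr ?_
      filter_upwards [hφτ] with t ht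
      refine propext (and_congr_left fun _ => ⟨hj_iff ht.symm g, hj_iff ht g⟩)
    have e3 : ν {y : Y | j (g • π y) = g ∧ g • y ∈ B} =
        ν ((fun y : Y => g • y) ⁻¹' ((j ∘ π) ⁻¹' {g} ∩ B)) := by
      refine measure_congr ?_
      filter_upwards [hπ.ae_equivariant] with y hy
      refine propext (and_congr_left fun _ => ?_)
      simp only [Set.mem_preimage, Function.comp, hy g, Set.mem_singleton_iff]
    rw [e1, measure_preimage_smul, e2, hφ.measure_preimage hE.nullMeasurableSet, e3,
      measure_preimage_smul]
  have hgood : ∀ᵐ x ∂μ, π (ρ₀ x) = j x • π (φ ((j x)⁻¹ • x)) ∧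
      τ (π (φ ((j x)⁻¹ • x))) = τ ((j x)⁻¹ • x) := by
    have h1 : ∀ᵐ t ∂μ, (∀ γ : Γ, π (γ • φ t) = γ • π (φ t)) ∧ τ (π (φ t)) = τ t :=
      (hφ.quasiMeasurePreserving.ae hπ.ae_equivariant).and hφτ
    -- The translate `(j x)⁻¹ • x` depends on `x`, so the property is secured for all of the
    -- countably many translates at once.
    have h2 : ∀ᵐ x ∂μ, ∀ g : Γ, (∀ γ : Γ, π (γ • φ (g • x)) = γ • π (φ (g • x))) ∧
        τ (π (φ (g • x))) = τ (g • x) :=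
      ae_all_iff.2 fun g => (measurePreserving_smul g μ).quasiMeasurePreserving.ae h1
    filter_upwards [h2] with x hx
    exact ⟨(hx _).1 _, (hx _).2⟩
  have hlabel : ∀ x, (π (ρ₀ x) = j x • π (φ ((j x)⁻¹ • x)) ∧
      τ (π (φ ((j x)⁻¹ • x))) = τ ((j x)⁻¹ • x)) → j (π (ρ₀ x)) = j x ∧ d (π (ρ₀ x)) = d x := by
    rintro x ⟨h1, h2⟩
    rw [h1]
    refine (hτmem (π (φ ((j x)⁻¹ • x))) (j x, d x)).1 ?_
    rw [h2, hτmem]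
    simp
  obtain ⟨N, hN, hNm, hN0⟩ := exists_measurable_superset_of_null (ae_iff.1 hgood)
  -- The value `ρ₀ x` determines `j x = j (π (ρ₀ x))`, after which `φ` and the group element can be
  -- undone.
  have hinj : Set.InjOn ρ₀ Nᶜ := by
    intro x hx x' hx' h
    have a := hlabel x (not_not.1 fun h => hx (hN h))
    have a' := hlabel x' (not_not.1 fun h => hx' (hN h))
    have hjj : j x = j x' := by rw [← a.1, h, a'.1]
    simp only [ρ₀, hjj, smul_left_cancel_iff, φ.injective.eq_iff] at h
    exact h
  obtain ⟨ρ, hρ, hρρ₀⟩ := exists_measurePreserving_equiv_of_map_eq (μ := μ) (ν := ν) hX hY hρ₀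
    measurable_id hNm.compl MeasurableSet.univ (by rwa [compl_compl]) (by simp) hinj
    (Set.injOn_id _) (by rw [hmap, Measure.map_id])
  refine ⟨ρ, φ, hρ, ?_⟩
  filter_upwards [hρρ₀, hgood] with x hx hx'
  have hx : ρ x = ρ₀ x := hx
  rw [hx]
  exact ⟨rfl, hlabel x hx'⟩

/-! ### Standard probability spaces and the main theorem. -/

namespace IsStandardProbabilitySpace

variable {X : Type*} [MeasurableSpace X] {μ : Measure X}

theorem isProbabilityMeasure (h : IsStandardProbabilitySpace μ) : IsProbabilityMeasure μ := by
  obtain ⟨e, he⟩ := h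
  refine ⟨?_⟩
  have h := he.measure_preimage (s := Set.univ) MeasurableSet.univ.nullMeasurableSet
  rw [Set.preimage_univ] at h
  exact h.trans measure_univ

theorem nullSingletonClass (h : IsStandardProbabilitySpace μ) : NullSingletonClass μ := by
  obtain ⟨e, he⟩ := h
  refine ⟨fun x => ?_⟩
  have : ({x} : Set X) = e ⁻¹' {e x} := by
    ext y
    simp
  rw [this, he.measure_preimage (measurableSet_singleton _).nullMeasurableSet, measure_singleton]

theorem standardBorelSpace (h : IsStandardProbabilitySpace μ) : StandardBorelSpace X := by
  obtain ⟨e, -⟩ := h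
  let : TopologicalSpace X := .induced e inferInstance
  refine ⟨inferInstance, ⟨?_⟩, e.toEquiv.polishSpace_induced⟩
  exact e.measurableEmbedding.comap_eq.symm.trans
    ((congrArg (MeasurableSpace.comap e) (BorelSpace.measurable_eq (α := unitInterval))).trans
      borel_comap.symm)

theorem not_countable (h : IsStandardProbabilitySpace μ) : ¬ Countable X := by
  intro hX
  have := h.isProbabilityMeasure
  have := h.nullSingletonClass
  have h0 : μ Set.univ = 0 := Set.Countable.measure_zero Set.countable_univ μ
  simp at h0

end IsStandardProbabilitySpace

/-- Hyperfiniteness of `θ` speaks only of spaces in `Type`, so the action is moved to the unit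
interval and the finite group action found there is pulled back. -/
theorem IsHyperfiniteIRS.isHyperfiniteAction {Γ X : Type*} [Group Γ] [MeasurableSpace X]
    {μ : Measure X} (hμ : IsStandardProbabilitySpace μ) [MulAction Γ X] [MeasurableConstSMul Γ X]
    [SMulInvariantMeasure Γ X μ] {θ : Measure (Subgroup Γ)} (hθ : IsHyperfiniteIRS θ)
    (hα : actionIRS Γ μ = θ) : IsHyperfiniteAction Γ μ := by
  have hst : Measurable fun x : X => MulAction.stabilizer Γ x := measurable_stabilizer hμ
  obtain ⟨e, he⟩ := hμ
  let : MulAction Γ unitInterval := e.symm.toEquiv.mulAction Γ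
  have hsmul : ∀ (γ : Γ) (z : unitInterval), γ • z = e (γ • e.symm z) := fun _ _ => rfl
  have hmp : ∀ γ : Γ, MeasurePreserving (fun z : unitInterval => γ • z) volume volume := fun γ =>
    he.comp ((measurePreserving_smul γ μ).comp (he.symm e))
  have : MeasurableConstSMul Γ unitInterval := ⟨fun γ => (hmp γ).measurable⟩
  have : SMulInvariantMeasure Γ unitInterval volume :=
    ⟨fun γ s hs => (hmp γ).measure_preimage hs.nullMeasurableSet⟩
  have hstd : IsStandardProbabilitySpace (volume : Measure unitInterval) :=
    ⟨MeasurableEquiv.refl _, MeasurePreserving.id _⟩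
  have hirs : actionIRS Γ (volume : Measure unitInterval) = θ := by
    rw [← hα, actionIRS, actionIRS, ← he.map_eq, Measure.map_map (measurable_stabilizer hstd)
      e.measurable]
    congr 1
    funext x
    ext γ
    simp [MulAction.mem_stabilizer_iff, hsmul]
  intro S ε hε
  obtain ⟨G, _, hGf, _, hG, hGS⟩ :=
    hθ.hyperfinite unitInterval volume hstd hirs S ε hε
  let : MulAction G X := e.toEquiv.mulAction G
  have hsmul' : ∀ (g : G) (x : X), g • x = e.symm (g • e x) := fun _ _ => rfl
  refine ⟨G, inferInstance, hGf, inferInstance, fun g => (he.symm e).comp ((hG g).comp he), ?_⟩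
  refine hGS.trans_eq ?_
  rw [measureReal_def, measureReal_def, ← he.measure_preimage_equiv]
  congr 2
  ext x
  simp only [Set.mem_preimage, Set.mem_ofPred_eq, MulAction.mem_orbit_iff, hsmul, hsmul',
    e.symm_apply_apply, e.symm_apply_eq]

theorem mainTheorem2 {Γ X Y : Type*} [Group Γ] [Countable Γ]
    [MeasurableSpace X] [MeasurableSpace Y] (μ : Measure X) (ν : Measure Y)
    (hμ : IsStandardProbabilitySpace μ) (hν : IsStandardProbabilitySpace ν)
    [MulAction Γ X] [MeasurableConstSMul Γ X] [SMulInvariantMeasure Γ X μ]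
    [MulAction Γ Y] [MeasurableConstSMul Γ Y] [SMulInvariantMeasure Γ Y ν]
    (θ : Measure (Subgroup Γ)) (hθ : IsHyperfiniteIRS θ)
    (hα : actionIRS Γ μ = θ) (hβ : actionIRS Γ ν = θ)
    (π : Y → X) (hπ : IsActionFactorMap Γ μ ν π)
    (k : ℕ) (A : Fin k → Set X) (B : Fin k → Set Y)
    (hA : ∀ i, MeasurableSet (A i)) (hB : ∀ i, MeasurableSet (B i))
    (hAB : ∀ i, π ⁻¹' (A i) = B i)
    (ε : ℝ) (hε : 0 < ε) (n : ℕ) (γ : Fin n → Γ) :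
    ∃ ρ : X ≃ᵐ Y, MeasurePreserving ρ μ ν ∧
      (∀ i, ρ '' (A i) =ᵐ[ν] B i) ∧
      1 - ε < μ.real {x : X | ∀ i, ρ (γ i • x) = γ i • ρ x} := by
  classical
  have := hμ.isProbabilityMeasure
  have := hν.isProbabilityMeasure
  have := hμ.nullSingletonClass
  have := hν.nullSingletonClass
  have := hμ.standardBorelSpace
  have := hν.standardBorelSpace
  obtain ⟨G, _, _, _, hG, hGε⟩ :=
    hθ.isHyperfiniteAction hμ hα (Finset.univ.image γ) ε hε
  obtain ⟨j, hj, hfin, hr⟩ := exists_measurable_section (Γ := Γ) fun g => (hG g).measurable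
  let r : X → X := fun x => (j x)⁻¹ • x
  have hΓ : ∀ γ : Γ, Measurable fun x : X => γ • x := fun γ => measurable_const_smul γ
  have hrm : Measurable r := measurable_of_fibers hj (F := fun γ x => γ⁻¹ • x) fun γ => hΓ γ⁻¹
  -- Records `j (γ i • x)` when `γ i` keeps the representative of `x`, and `none` otherwise.
  let q : Fin n → X → Option Γ := fun i x => if r (γ i • x) = r x then some (j (γ i • x)) else none
  have hq : ∀ i a, MeasurableSet {x | q i x = a} := by
    intro i a
    have h1 : MeasurableSet {x | r (γ i • x) = r x} :=
      measurableSet_eq_fun (hrm.comp (hΓ _)) hrm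
    cases a with
    | none =>
      have : {x | q i x = none} = {x | r (γ i • x) = r x}ᶜ := by
        ext x
        simp [q]
      rw [this]
      exact h1.compl
    | some g =>
      have : {x | q i x = some g} = {x | r (γ i • x) = r x} ∩ {x | j (γ i • x) = g} := by
        ext x
        simp [q]
      rw [this]
      exact h1.inter (hΓ (γ i) (hj g))
  let d : X → Set (Fin k) × (Fin n → Option Γ) := fun x => ({i | x ∈ A i}, fun i => q i x)
  have hd : ∀ a, MeasurableSet (d ⁻¹' {a}) := by
    rintro ⟨a, b⟩
    have : d ⁻¹' {(a, b)} = (⋂ i, {x | x ∈ A i ↔ i ∈ a}) ∩ ⋂ i, {x | q i x = b i} := by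
      ext x
      simp [d, Prod.ext_iff, Set.ext_iff, funext_iff]
    rw [this]
    refine (MeasurableSet.iInter fun i => ?_).inter (.iInter fun i => hq i (b i))
    by_cases hi : i ∈ a
    · simp only [hi, iff_true]
      exact hA i
    · simp only [hi, iff_false]
      exact (hA i).compl
  obtain ⟨ρ, φ, hρ, hρd⟩ := exists_equiv_of_section hμ.not_countable hν.not_countable hπ hj hfin hd
  refine ⟨ρ, hρ, fun i => ?_, hGε.trans_le ?_⟩
  · have h1 : ∀ᵐ x ∂μ, x ∈ A i ↔ ρ x ∈ B i := by
      filter_upwards [hρd] with x hx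
      rw [← hAB i]
      exact (Set.ext_iff.1 (congrArg Prod.fst hx.2.2) i).symm
    filter_upwards [(hρ.symm ρ).quasiMeasurePreserving.ae h1] with y hy
    refine propext ?_
    rw [ρ.apply_symm_apply] at hy
    change y ∈ ρ '' A i ↔ y ∈ B i
    rw [← hy]
    constructor
    · rintro ⟨x, hx, rfl⟩
      rwa [ρ.symm_apply_apply]
    · exact fun h => ⟨_, h, ρ.apply_symm_apply y⟩
  · have h1 := hρ.quasiMeasurePreserving.ae
      (hπ.ae_equivariant.and (ae_smul_eq_iff_of_actionIRS_eq hμ hν (hα.trans hβ.symm) hπ))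
    have h2 : ∀ᵐ x ∂μ, ∀ i, ρ (γ i • x) = j (γ i • x) • φ (r (γ i • x)) :=
      ae_all_iff.2 fun i => (measurePreserving_smul (γ i) μ).quasiMeasurePreserving.ae
        (hρd.mono fun x hx => hx.1)
    refine ENNReal.toReal_mono (measure_ne_top _ _) (measure_mono_ae ?_)
    filter_upwards [hρd, h1, h2] with x ⟨hx1, hx2, hx3⟩ ⟨hx4, hx5⟩ hx6 hxS i
    have hri : r (γ i • x) = r x :=
      hr x (γ i) (hxS (γ i) (Finset.mem_image_of_mem γ (Finset.mem_univ i)))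
    -- Matching data: at `π (ρ x)` too, `γ i` keeps the representative, with the same value of `j`
    -- as at `γ i • x`.
    have hqi : q i (π (ρ x)) = some (j (γ i • x)) := by
      rw [show q i (π (ρ x)) = q i x from congrFun (congrArg Prod.snd hx3) i]
      simp only [q, if_pos hri]
    obtain ⟨h, hji⟩ : r (γ i • π (ρ x)) = r (π (ρ x)) ∧ j (γ i • π (ρ x)) = j (γ i • x) := by
      simpa only [q, Option.ite_none_right_eq_some, Option.some.injEq] using hqi
    simp only [r, hji, hx2] at h
    rw [hx6 i, hri]
    have hφ : φ (r x) = (j x)⁻¹ • ρ x := by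
      rw [hx1, inv_smul_smul]
    rw [hφ]
    -- The discrepancy between `ρ (γ i • x)` and `γ i • ρ x`, seen in `X`; equality of stabilizers
    -- lifts it to `Y`.
    have hfix : ((γ i)⁻¹ * (j (γ i • x) * (j x)⁻¹)) • π (ρ x) = π (ρ x) := by
      rw [mul_smul, mul_smul, ← h, smul_inv_smul, inv_smul_smul]
    have := (hx5 _).2 hfix
    rwa [mul_smul, inv_smul_eq_iff, mul_smul] at this
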